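/- Let $G$ be a finite simple undirected weighted graph with vertex set $\{1,\dots,n\}$, $n\ge 1$, and a positive weight $d_{uv}=d_{vu}$ on each edge $\{u,v\}$ (the unweighted case is $d_{uv}=1$). Let $\lambda_1,\dots,\lambda_n\in\mathbb R$ be the eigenvalues, counted with multiplicity, of its adjacency matrix, whose $(u,v)$ entry is $d_{uv}$ if $\{u,v\}$ is an edge and $0$ otherwise. Let $p\ge 1$ be an integer and let $\Gamma$ be the infinite graph obtained from $G$ by attaching $p$ infinite rays to every vertex: for each vertex $v$ of $G$ and each $i\in\{1,\dots,p\}$ there are new vertices $(v,i,0),(v,i,1),(v,i,2),\dots$, and new edges of weight $1$ joining $v$ to $(v,i,0)$ and $(v,i,j)$ to $(v,i,j+1)$ for all $j\ge 0$. Let $A(\Gamma)$ be the adjacency operator of $\Gamma$, that is, the bounded operator on the complex Hilbert space $\ell^2$ of the vertex set of $\Gamma$ given by its adjacency matrix. For a bounded real sequence $b_1,b_2,\dots$ and a bounded sequence $a_1,a_2,\dots>0$ let $J(\{b_j\},\{a_j\})$ be the operator on $\ell^2(\mathbb N)$ given by the symmetric tridiagonal matrix with diagonal $b_1,b_2,\dots$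 and off-diagonal $a_1,a_2,\dots$. Put $$J_0:=J(\{0,0,\dots\},\{1,1,\dots\}),\qquad J(\lambda,\sqrt p):=J(\{\lambda,0,0,\dots\},\{\sqrt p,1,1,\dots\}).$$ Then $A(\Gamma)$ is unitarily equivalent to the orthogonal sum $$\bigoplus_{j=1}^n J(\lambda_j,\sqrt p)\ \oplus\ \bigoplus_{i=1}^{(p-1)n}J_0 ,$$ and the spectrum of $A(\Gamma)$ is $$\sigma(\Gamma)=[-2,2]\ \cup\ \bigcup_{j=1}^n\sigma_d\bigl(J(\lambda_j,\sqrt p)\bigr),$$ where $\sigma_d(T)$ is the discrete spectrum of the bounded self-adjoint operator $T$, the set of eigenvalues of finite multiplicity that are isolated points of the spectrum of $T$. -/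

import Mathlib

open scoped ENNReal NNReal

/-! ### Weighted graphs -/

/-- A weighted graph: a simple undirected graph with a positive weight on each edge.  (Values of
`weight` off the edges play no role.) -/
structure WeightedGraph (V : Type*) extends SimpleGraph V where
  /-- the weight of the edge `{u, v}` -/
  weight : V → V → ℝ
  weight_symm : ∀ u v, weight u v = weight v u
  weight_pos : ∀ u v, Adj u v → 0 < weight u v

namespace WeightedGraph

/-- The (possibly infinite) adjacency matrix: `a u v` is the weight of `{u, v}` if this is an
edge, and `0` otherwise. -/
noncomputable def adjMatrix {V : Type*} (G : WeightedGraph V) : Matrix V V ℝ :=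
  open Classical in fun u v => if G.Adj u v then G.weight u v else 0

/-- Adjacency in the graph obtained from `G` by attaching `p` infinite rays to each vertex.
The new vertices are the `(v, i, j)`: the vertex number `j = 0, 1, 2, …` of the `i`-th ray
attached to the vertex `v` of `G`. -/
def sunAdj {V : Type*} (G : WeightedGraph V) (p : ℕ) :
    V ⊕ (V × Fin p × ℕ) → V ⊕ (V × Fin p × ℕ) → Prop
  | .inl u, .inl v => G.Adj u v
  | .inl u, .inr (v, _, j) => u = v ∧ j = 0
  | .inr (v, _, j), .inl u => u = v ∧ j = 0
  | .inr (u, i, j), .inr (v, k, l) => u = v ∧ i = k ∧ (l = j + 1 ∨ j = l + 1)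

/-- The edges of `G` keep their weights; the edges of the rays, and the edges joining the rays
to `G`, have weight `1`. -/
def sunWeight {V : Type*} (G : WeightedGraph V) (p : ℕ) :
    V ⊕ (V × Fin p × ℕ) → V ⊕ (V × Fin p × ℕ) → ℝ
  | .inl u, .inl v => G.weight u v
  | _, _ => 1

/-- The weighted graph obtained from `G` by attaching `p` infinite (unweighted) rays to each
vertex. -/
def sun {V : Type*} (G : WeightedGraph V) (p : ℕ) : WeightedGraph (V ⊕ (V × Fin p × ℕ)) where
  Adj := G.sunAdj p
  symm := ⟨by
    rintro (u | ⟨u, i, j⟩) (v | ⟨v, k, l⟩) h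
    · exact G.symm.symm _ _ h
    · exact h
    · exact h
    · obtain ⟨h1, h2, h3⟩ := h
      exact ⟨h1.symm, h2.symm, h3.symm⟩⟩
  loopless := ⟨by
    rintro (u | ⟨u, i, j⟩) h
    · exact G.loopless.irrefl u h
    · obtain ⟨-, -, h3⟩ := h
      omega⟩
  weight := G.sunWeight p
  weight_symm := by
    rintro (u | ⟨u, i, j⟩) (v | ⟨v, k, l⟩)
    · exact G.weight_symm u v
    all_goals rfl
  weight_pos := by
    rintro (u | ⟨u, i, j⟩) (v | ⟨v, k, l⟩) h
    · exact G.weight_pos u v h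
    all_goals exact one_pos

end WeightedGraph

/-! ### Bounded operators on `ℓ²` given by matrices -/

/-- The Hilbert space `ℓ²(ι)` of square summable complex families. -/
noncomputable abbrev Ell2 (ι : Type*) := lp (fun _ : ι => ℂ) 2

/-- The absolute row sums and the absolute column sums of the matrix are uniformly bounded. -/
def BoundedSums {ι : Type*} (a : Matrix ι ι ℝ) : Prop :=
  ∃ C : ℝ≥0, (∀ i, ∑' k, ‖a i k‖ₑ ≤ C) ∧ ∀ k, ∑' i, ‖a i k‖ₑ ≤ C

section MatrixOperator

variable {ι : Type*} {a : Matrix ι ι ℝ}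

theorem BoundedSums.summable (h : BoundedSums a) (x : Ell2 ι) (i : ι) :
    Summable fun k => (a i k : ℂ) * x k := by
  obtain ⟨C, hC, -⟩ := h
  have h1 : Summable fun k => ‖a i k‖ := by
    have h2 : ∑' k, ENNReal.ofReal ‖a i k‖ ≠ ⊤ := by
      simp only [ofReal_norm]
      exact ne_top_of_le_ne_top ENNReal.coe_ne_top (hC i)
    simpa using ENNReal.summable_toReal h2
  refine Summable.of_norm_bounded (h1.mul_right ‖x‖) fun k => ?_
  rw [norm_mul, Complex.norm_real]
  exact mul_le_mul_of_nonneg_left (lp.norm_apply_le_norm (by norm_num) x k) (norm_nonneg _)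

theorem sq_tsum_mul_le (b y : ι → ℝ≥0∞) :
    (∑' k, b k * y k) ^ 2 ≤ (∑' k, b k) * ∑' k, b k * y k ^ 2 := by
  have key : ∀ s t : ℝ≥0∞, 2 * (s * t) ≤ s ^ 2 + t ^ 2 := by
    intro s t
    rcases eq_or_ne s ⊤ with rfl | hs
    · simp
    rcases eq_or_ne t ⊤ with rfl | ht
    · simp
    lift s to ℝ≥0 using hs
    lift t to ℝ≥0 using ht
    have := two_mul_le_add_sq s t
    rw [mul_assoc] at this
    exact_mod_cast this
  have h2 : 2 * (∑' k, b k * y k) ^ 2 ≤ 2 * ((∑' k, b k) * ∑' k, b k * y k ^ 2) := by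
    calc 2 * (∑' k, b k * y k) ^ 2
        = ∑' k, ∑' l, b k * b l * (2 * (y k * y l)) := by
          rw [sq, ← ENNReal.tsum_mul_right, ← ENNReal.tsum_mul_left]
          refine tsum_congr fun k => ?_
          rw [← ENNReal.tsum_mul_left, ← ENNReal.tsum_mul_left]
          exact tsum_congr fun l => by ring
      _ ≤ ∑' k, ∑' l, b k * b l * (y k ^ 2 + y l ^ 2) :=
          ENNReal.tsum_le_tsum fun k => ENNReal.tsum_le_tsum fun l => mul_right_mono (key _ _)
      _ = ∑' k, ∑' l, b l * (b k * y k ^ 2) + ∑' k, ∑' l, b k * (b l * y l ^ 2) := by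
          rw [← ENNReal.tsum_add]
          refine tsum_congr fun k => ?_
          rw [← ENNReal.tsum_add]
          exact tsum_congr fun l => by ring
      _ = 2 * ((∑' k, b k) * ∑' k, b k * y k ^ 2) := by
          simp only [ENNReal.tsum_mul_left, ENNReal.tsum_mul_right]
          ring
  exact (ENNReal.mul_le_mul_iff_right (by norm_num) (by norm_num)).1 h2

theorem tsum_enorm_sq (x : Ell2 ι) : ∑' k, ‖x k‖ₑ ^ 2 = ENNReal.ofReal (‖x‖ ^ 2) := by
  have h1 := lp.hasSum_norm (p := 2) (by norm_num) x
  norm_num at h1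
  rw [← h1.tsum_eq, ENNReal.ofReal_tsum_of_nonneg (fun _ => by positivity) h1.summable]
  refine tsum_congr fun k => ?_
  rw [ENNReal.ofReal_pow (norm_nonneg _), ofReal_norm]

/-- Schur's test. -/
theorem tsum_enorm_sq_mul_le {C : ℝ≥0} (h₁ : ∀ i, ∑' k, ‖a i k‖ₑ ≤ C)
    (h₂ : ∀ k, ∑' i, ‖a i k‖ₑ ≤ C) (x : Ell2 ι) :
    ∑' i, ‖∑' k, (a i k : ℂ) * x k‖ₑ ^ 2 ≤ ENNReal.ofReal ((C * ‖x‖) ^ 2) := by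
  calc ∑' i, ‖∑' k, (a i k : ℂ) * x k‖ₑ ^ 2
      ≤ ∑' i, C * ∑' k, ‖a i k‖ₑ * ‖x k‖ₑ ^ 2 := by
        refine ENNReal.tsum_le_tsum fun i => ?_
        calc ‖∑' k, (a i k : ℂ) * x k‖ₑ ^ 2
            ≤ (∑' k, ‖(a i k : ℂ) * x k‖ₑ) ^ 2 := by
              gcongr
              exact enorm_tsum_le_tsum_enorm
          _ = (∑' k, ‖a i k‖ₑ * ‖x k‖ₑ) ^ 2 := by
              congr 1
              refine tsum_congr fun k => ?_
              rw [enorm_mul, ← ofReal_norm, Complex.norm_real, ofReal_norm]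
          _ ≤ (∑' k, ‖a i k‖ₑ) * ∑' k, ‖a i k‖ₑ * ‖x k‖ₑ ^ 2 := sq_tsum_mul_le _ _
          _ ≤ _ := by gcongr; exact h₁ i
    _ = C * ∑' k, (∑' i, ‖a i k‖ₑ) * ‖x k‖ₑ ^ 2 := by
        rw [ENNReal.tsum_mul_left, ENNReal.tsum_comm]
        simp only [ENNReal.tsum_mul_right]
    _ ≤ C * ∑' k, C * ‖x k‖ₑ ^ 2 := by
        gcongr with k
        exact h₂ k
    _ = ENNReal.ofReal ((C * ‖x‖) ^ 2) := by
        rw [ENNReal.tsum_mul_left, tsum_enorm_sq, mul_pow, ENNReal.ofReal_mul (by positivity),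
          ENNReal.ofReal_pow (p := (C : ℝ)) (by positivity), ENNReal.ofReal_coe_nnreal]
        ring

theorem BoundedSums.memℓp (h : BoundedSums a) (x : Ell2 ι) :
    Memℓp (fun i => ∑' k, (a i k : ℂ) * x k) 2 := by
  obtain ⟨C, h₁, h₂⟩ := h
  refine memℓp_gen ?_
  have h3 := tsum_enorm_sq_mul_le h₁ h₂ x
  have h4 := ENNReal.summable_toReal (ne_top_of_le_ne_top ENNReal.ofReal_ne_top h3)
  simpa using h4

/-- The bounded operator on `ℓ²(ι)` given by the matrix `a`, that is, `(T x) i = ∑ k, a i k * x k`;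
its boundedness is Schur's test. -/
noncomputable def matrixOperator (a : Matrix ι ι ℝ) (h : BoundedSums a) :
    Ell2 ι →L[ℂ] Ell2 ι :=
  LinearMap.mkContinuousOfExistsBound
    { toFun := fun x => ⟨fun i => ∑' k, (a i k : ℂ) * x k, h.memℓp x⟩
      map_add' := fun x y => by
        ext i
        change ∑' k, (a i k : ℂ) * (x k + y k)
          = ∑' k, (a i k : ℂ) * x k + ∑' k, (a i k : ℂ) * y k
        rw [← (h.summable x i).tsum_add (h.summable y i)]
        exact tsum_congr fun k => mul_add _ _ _
      map_smul' := fun c x => by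
        ext i
        change ∑' k, (a i k : ℂ) * (c * x k) = c * ∑' k, (a i k : ℂ) * x k
        rw [← tsum_mul_left]
        exact tsum_congr fun k => by ring }
    (by
      obtain ⟨C, h₁, h₂⟩ := id h
      refine ⟨C, fun x => ?_⟩
      have h3 := tsum_enorm_sq_mul_le h₁ h₂ x
      have h4 := tsum_enorm_sq (ι := ι) ⟨fun i => ∑' k, (a i k : ℂ) * x k, h.memℓp x⟩
      change ∑' i, ‖∑' k, (a i k : ℂ) * x k‖ₑ ^ 2 = _ at h4
      rw [h4, ENNReal.ofReal_le_ofReal_iff (by positivity)] at h3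
      exact le_of_sq_le_sq h3 (by positivity))

theorem matrixOperator_apply (h : BoundedSums a) (x : Ell2 ι) (i : ι) :
    matrixOperator a h x i = ∑' k, (a i k : ℂ) * x k := rfl

/-- The columns of the matrix are the images of the standard basis vectors. -/
theorem matrixOperator_single [DecidableEq ι] (h : BoundedSums a) (i k : ι) :
    matrixOperator a h (lp.single 2 k 1) i = a i k := by
  rw [matrixOperator_apply, tsum_eq_single k]
  · simp
  · intro l hl
    simp [lp.single_apply, Pi.single_eq_of_ne hl]

end MatrixOperator

/-! ### The adjacency operator -/

theorem WeightedGraph.adjMatrix_symm {V : Type*} (G : WeightedGraph V) (u v : V) :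
    G.adjMatrix u v = G.adjMatrix v u := by
  classical
  unfold WeightedGraph.adjMatrix
  simp only [G.adj_comm u v, G.weight_symm u v]

theorem WeightedGraph.boundedSums_sun {V : Type*} [Finite V] (G : WeightedGraph V) (p : ℕ) :
    BoundedSums (G.sun p).adjMatrix := by
  classical
  have := Fintype.ofFinite V
  suffices h : ∃ C : ℝ≥0, ∀ i, ∑' k, ‖(G.sun p).adjMatrix i k‖ₑ ≤ C by
    obtain ⟨C, hC⟩ := h
    refine ⟨C, hC, fun k => ?_⟩
    simpa only [fun i => (G.sun p).adjMatrix_symm i k] using hC k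
  -- a row has its nonzero entries in a finite set, and they are bounded
  obtain ⟨M, hM⟩ : ∃ M : ℝ≥0, ∀ i k, ‖(G.sun p).adjMatrix i k‖ₑ ≤ M := by
    refine ⟨1 + ∑ u, ∑ v, ‖G.weight u v‖₊, fun i k => ?_⟩
    rw [enorm_eq_nnnorm, ENNReal.coe_le_coe]
    unfold WeightedGraph.adjMatrix
    split_ifs with h
    · rcases i with u | ⟨u, i, j⟩
      · rcases k with v | ⟨v, k, l⟩
        · refine le_trans ?_ le_add_self
          refine le_trans ?_ (Finset.single_le_sum (f := fun u => ∑ v, ‖G.weight u v‖₊)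
            (fun _ _ => by positivity) (Finset.mem_univ u))
          exact Finset.single_le_sum (f := fun v => ‖G.weight u v‖₊)
            (fun _ _ => by positivity) (Finset.mem_univ v)
        · exact le_trans (by simp [WeightedGraph.sun, WeightedGraph.sunWeight]) le_self_add
      · exact le_trans (by simp [WeightedGraph.sun, WeightedGraph.sunWeight]) le_self_add
    · simp
  have hrow : ∀ i, ∃ s : Finset (V ⊕ (V × Fin p × ℕ)),
      s.card ≤ Fintype.card V + Fintype.card (V × Fin p) * 3 ∧
      ∀ k, k ∉ s → (G.sun p).adjMatrix i k = 0 := by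
    intro i
    let N : ℕ := match i with
      | .inl _ => 0
      | .inr (_, _, j) => j
    refine ⟨Finset.univ.disjSum ((Finset.univ : Finset V) ×ˢ
      ((Finset.univ : Finset (Fin p)) ×ˢ ({N - 1, N, N + 1} : Finset ℕ))), ?_, ?_⟩
    · rw [Finset.card_disjSum, Finset.card_product, Finset.card_product, Fintype.card_prod,
        mul_assoc]
      simp only [Finset.card_univ]
      gcongr
      exact Finset.card_le_three
    · intro k hk
      refine if_neg fun hadj => hk ?_
      rcases k with v | ⟨v, k, l⟩
      · simp
      · rcases i with u | ⟨u, i, j⟩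
        · have h0 : l = 0 := hadj.2
          simp [N, h0]
        · have h0 : l = j + 1 ∨ j = l + 1 := hadj.2.2
          simp only [Finset.inr_mem_disjSum, Finset.mem_product, Finset.mem_univ, true_and,
            Finset.mem_insert, Finset.mem_singleton, N]
          omega
  refine ⟨(Fintype.card V + Fintype.card (V × Fin p) * 3 : ℕ) * M, fun i => ?_⟩
  obtain ⟨s, hs, h0⟩ := hrow i
  rw [tsum_eq_sum (s := s) fun k hk => by simp [h0 k hk]]
  refine (Finset.sum_le_card_nsmul s _ (M : ℝ≥0∞) fun k _ => hM i k).trans ?_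
  rw [nsmul_eq_mul, ENNReal.coe_mul, ENNReal.coe_natCast]
  gcongr

/-- The adjacency operator, on `ℓ²` of the vertex set, of the graph obtained from the finite
graph `G` by attaching `p` infinite rays to each vertex. -/
noncomputable def WeightedGraph.sunOperator {V : Type*} [Finite V] (G : WeightedGraph V) (p : ℕ) :
    Ell2 (V ⊕ (V × Fin p × ℕ)) →L[ℂ] Ell2 (V ⊕ (V × Fin p × ℕ)) :=
  matrixOperator (G.sun p).adjMatrix (G.boundedSums_sun p)

/-! ### Jacobi operators -/

/-- The one-sided infinite Jacobi matrix with diagonal `b 0, b 1, …` and off-diagonal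
`a 0, a 1, …`. -/
def jacobiMatrix (b a : ℕ → ℝ) : Matrix ℕ ℕ ℝ := fun i k =>
  if i = k then b i else if k = i + 1 then a i else if i = k + 1 then a k else 0

theorem jacobiMatrix_symm (b a : ℕ → ℝ) (i k : ℕ) :
    jacobiMatrix b a i k = jacobiMatrix b a k i := by
  unfold jacobiMatrix
  split_ifs <;> first | rfl | omega | (subst_vars; rfl)

theorem boundedSums_jacobiMatrix (b a : ℕ → ℝ) (hb : ∃ B, ∀ j, |b j| ≤ B)
    (ha : ∃ A, ∀ j, |a j| ≤ A) : BoundedSums (jacobiMatrix b a) := by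
  obtain ⟨B, hB⟩ := hb
  obtain ⟨A, hA⟩ := ha
  suffices h : ∃ C : ℝ≥0, ∀ i, ∑' k, ‖jacobiMatrix b a i k‖ₑ ≤ C by
    obtain ⟨C, hC⟩ := h
    refine ⟨C, hC, fun k => ?_⟩
    simpa only [fun i => jacobiMatrix_symm b a i k] using hC k
  have hM : ∀ i k, ‖jacobiMatrix b a i k‖ₑ ≤ (max B A).toNNReal := by
    intro i k
    rw [← ofReal_norm, Real.norm_eq_abs]
    refine ENNReal.ofReal_le_ofReal ?_
    have h0 : 0 ≤ max B A := (abs_nonneg _).trans ((hB 0).trans (le_max_left _ _))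
    unfold jacobiMatrix
    split_ifs
    · exact (hB i).trans (le_max_left _ _)
    · exact (hA i).trans (le_max_right _ _)
    · exact (hA k).trans (le_max_right _ _)
    · simpa using h0
  refine ⟨3 * (max B A).toNNReal, fun i => ?_⟩
  rw [tsum_eq_sum (s := {i - 1, i, i + 1}) ?_]
  · refine (Finset.sum_le_card_nsmul _ _ _ fun k _ => hM i k).trans ?_
    rw [nsmul_eq_mul, ENNReal.coe_mul]
    gcongr
    exact_mod_cast Finset.card_le_three
  · intro k hk
    simp only [Finset.mem_insert, Finset.mem_singleton, not_or] at hk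
    have : jacobiMatrix b a i k = 0 := by
      unfold jacobiMatrix
      rw [if_neg (by omega), if_neg (by omega), if_neg (by omega)]
    simp [this]

/-- The bounded Jacobi operator on `ℓ²(ℕ)`. -/
noncomputable def jacobiOperator (b a : ℕ → ℝ) (hb : ∃ B, ∀ j, |b j| ≤ B)
    (ha : ∃ A, ∀ j, |a j| ≤ A) : Ell2 ℕ →L[ℂ] Ell2 ℕ :=
  matrixOperator (jacobiMatrix b a) (boundedSums_jacobiMatrix b a hb ha)

theorem exists_bound_headTail (s t : ℝ) :
    ∃ B, ∀ j : ℕ, |(if j = 0 then s else t)| ≤ B :=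
  ⟨max |s| |t|, fun j => by split_ifs <;> simp⟩

/-- The Jacobi operator `J({μ, 0, 0, …}, {s, 1, 1, …})`. -/
noncomputable def jacobiHead (μ s : ℝ) : Ell2 ℕ →L[ℂ] Ell2 ℕ :=
  jacobiOperator (fun j => if j = 0 then μ else 0) (fun j => if j = 0 then s else 1)
    (exists_bound_headTail μ 0) (exists_bound_headTail s 1)

/-- The free Jacobi operator `J₀ = J({0, 0, …}, {1, 1, …})`. -/
noncomputable def freeJacobi : Ell2 ℕ →L[ℂ] Ell2 ℕ :=
  jacobiOperator (fun _ => 0) (fun _ => 1) ⟨0, by simp⟩ ⟨1, by simp⟩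

/-! ### Orthogonal sums, unitary equivalence, discrete spectrum -/

/-- The orthogonal sum `⨁ i, T i` of finitely many bounded operators on a Hilbert space `H`,
acting on the orthogonal sum of copies of `H`. -/
noncomputable def orthogonalSum {I H : Type*} [Fintype I] [NormedAddCommGroup H]
    [InnerProductSpace ℂ H] (T : I → H →L[ℂ] H) :
    PiLp 2 (fun _ : I => H) →L[ℂ] PiLp 2 (fun _ : I => H) :=
  ((PiLp.continuousLinearEquiv 2 ℂ fun _ : I => H).symm :
      (I → H) →L[ℂ] PiLp 2 (fun _ : I => H)) ∘L
    ContinuousLinearMap.piMap T ∘L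
    (PiLp.continuousLinearEquiv 2 ℂ fun _ : I => H : PiLp 2 (fun _ : I => H) →L[ℂ] (I → H))

theorem orthogonalSum_apply {I H : Type*} [Fintype I] [NormedAddCommGroup H]
    [InnerProductSpace ℂ H] (T : I → H →L[ℂ] H) (x : PiLp 2 (fun _ : I => H)) (i : I) :
    orthogonalSum T x i = T i (x i) := rfl

/-- Two bounded operators are unitarily equivalent. -/
def UnitarilyEquivalent {H K : Type*} [NormedAddCommGroup H] [InnerProductSpace ℂ H]
    [NormedAddCommGroup K] [InnerProductSpace ℂ K] (S : H →L[ℂ] H) (T : K →L[ℂ] K) : Prop :=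
  ∃ U : H ≃ₗᵢ[ℂ] K, ∀ x, U (S x) = T (U x)

/-- The discrete spectrum of a bounded self-adjoint operator: the eigenvalues of finite
multiplicity that are isolated points of the spectrum. -/
def discreteSpectrum {H : Type*} [NormedAddCommGroup H] [InnerProductSpace ℂ H]
    (T : H →L[ℂ] H) : Set ℂ :=
  {z | Module.End.HasEigenvalue (T : H →ₗ[ℂ] H) z ∧
    FiniteDimensional ℂ (Module.End.eigenspace (T : H →ₗ[ℂ] H) z) ∧
    ¬ AccPt z (Filter.principal (spectrum ℂ T))}

/-! ### Decaying solutions of the three-term recurrence -/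

section Recurrence

/-! Decomposition. Each level of the rays is a copy of `ℂ^(V × Fin p)`, and the adjacency operator
shifts levels; the first level is coupled to `G` by copying the value at `v` to its `p` rays. Let
the rows `B j` be an orthonormal eigenbasis of the adjacency matrix of `G`. The vectors `B j v / √p`
on `V × Fin p` are orthonormal; complete them to an orthogonal matrix `W`. The `(p - 1) n` added
rows are orthogonal to everything constant along the rays at each vertex, so they decouple from `G`
and carry copies of `J₀`. The row `j` starts at the eigenvector `B j` and is coupled to it by `√p`,
which gives `J(λ_j, √p)`. Applying `B` on `G` and `W` on each level is unitary
(`exists_linearIsometryEquiv_sunToRays`).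

Spectrum. A finite orthogonal sum has the union of the spectra, so one Jacobi operator has to be
understood. It is a finite-rank perturbation of `J₀`, which is self-adjoint of norm at most `2`;
outside `[-2, 2]` its spectrum thus consists of eigenvalues
(`hasEigenvalue_of_isCompactOperator_sub`). These are simple, and finite in number because a
decaying solution annihilates a quadratic invariant (`three_term_invariant`); so they are isolated.
For `|E| < 2` the same invariant is positive definite, which forbids decaying solutions and puts
`[-2, 2]` in the spectrum (`Icc_subset_spectrum_jacobiHead`). -/

/-- The quadratic form is constant in `k`: consecutive values differ by `y (k + 2) - y k` times the
defect of the recurrence. Decay makes the constant zero. -/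
theorem three_term_invariant {𝕜 : Type*} [NormedField 𝕜] {E : 𝕜} {y : ℕ → 𝕜}
    (h : ∀ k, y k + y (k + 2) = E * y (k + 1))
    (hy : Filter.Tendsto y Filter.atTop (nhds 0)) :
    y 1 ^ 2 - E * y 1 * y 0 + y 0 ^ 2 = 0 := by
  have hc : ∀ k, y (k + 1) ^ 2 - E * y (k + 1) * y k + y k ^ 2
      = y 1 ^ 2 - E * y 1 * y 0 + y 0 ^ 2 := by
    intro k
    induction k with
    | zero => rfl
    | succ k ih =>
      rw [← ih]
      linear_combination (y (k + 2) - y k) * h k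
  have h1 : Filter.Tendsto (fun k => y (k + 1)) Filter.atTop (nhds 0) :=
    (Filter.tendsto_add_atTop_iff_nat 1).2 hy
  have h2 := ((h1.pow 2).sub ((h1.const_mul E).mul hy)).add (hy.pow 2)
  simp only [hc] at h2
  have h3 := tendsto_nhds_unique h2 tendsto_const_nhds
  simpa using h3.symm

/-- Completing the square, the form is `(y 0 - E / 2 * y 1) ^ 2 + (1 - E ^ 2 / 4) * y 1 ^ 2`,
positive definite for `|E| < 2`. -/
theorem three_term_real_eq_zero {E : ℝ} (hE : |E| < 2) {y : ℕ → ℝ}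
    (h : ∀ k, y k + y (k + 2) = E * y (k + 1))
    (hy : Filter.Tendsto y Filter.atTop (nhds 0)) : y 0 = 0 ∧ y 1 = 0 := by
  have h1 := three_term_invariant h hy
  have h2 : E ^ 2 < 4 := by
    have := sq_lt_sq' (abs_lt.1 hE).1 (abs_lt.1 hE).2
    linarith
  have h3 : (1 - E ^ 2 / 4) * y 1 ^ 2 = 0 := by
    have h4 : 0 ≤ (1 - E ^ 2 / 4) * y 1 ^ 2 := mul_nonneg (by linarith) (sq_nonneg _)
    nlinarith [sq_nonneg (y 0 - E / 2 * y 1)]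
  have h4 : y 1 = 0 := by
    rcases mul_eq_zero.1 h3 with h5 | h5
    · linarith
    · exact pow_eq_zero_iff (by norm_num) |>.1 h5
  rw [h4] at h1
  exact ⟨pow_eq_zero_iff (n := 2) (by norm_num) |>.1 (by linarith), h4⟩

/-- The form is not definite over `ℂ`, but `E` is real, so real and imaginary parts solve the
recurrence separately. -/
theorem three_term_complex_eq_zero {E : ℝ} (hE : |E| < 2) {y : ℕ → ℂ}
    (h : ∀ k, y k + y (k + 2) = E * y (k + 1))
    (hy : Filter.Tendsto y Filter.atTop (nhds 0)) : y 0 = 0 ∧ y 1 = 0 := by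
  have hre := three_term_real_eq_zero hE (y := fun k => (y k).re)
    (fun k => by simpa using congrArg Complex.re (h k))
    (by simpa [Function.comp_def] using (Complex.continuous_re.tendsto 0).comp hy)
  have him := three_term_real_eq_zero hE (y := fun k => (y k).im)
    (fun k => by simpa using congrArg Complex.im (h k))
    (by simpa [Function.comp_def] using (Complex.continuous_im.tendsto 0).comp hy)
  exact ⟨Complex.ext hre.1 him.1, Complex.ext hre.2 him.2⟩

end Recurrence

/-! ### Decay, norm bound and self-adjointness on `ℓ²` -/

section Ell2

theorem Ell2.tendsto_zero (x : Ell2 ℕ) :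
    Filter.Tendsto (fun k => x k) Filter.atTop (nhds 0) := by
  have h1 := (lp.hasSum_norm (p := 2) (by norm_num) x).summable.tendsto_atTop_zero
  norm_num at h1
  rw [tendsto_zero_iff_norm_tendsto_zero]
  have h2 := (Real.continuous_sqrt.tendsto 0).comp h1
  simpa [Function.comp_def, Real.sqrt_sq (norm_nonneg _)] using h2

end Ell2

section MatrixOperatorBounds

variable {ι : Type*} {a : Matrix ι ι ℝ}

theorem norm_matrixOperator_le (h : BoundedSums a) {C : ℝ≥0} (h₁ : ∀ i, ∑' k, ‖a i k‖ₑ ≤ C)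
    (h₂ : ∀ k, ∑' i, ‖a i k‖ₑ ≤ C) : ‖matrixOperator a h‖ ≤ C := by
  refine ContinuousLinearMap.opNorm_le_bound _ C.2 fun x => ?_
  have h3 := tsum_enorm_sq_mul_le h₁ h₂ x
  have h4 := tsum_enorm_sq (matrixOperator a h x)
  simp only [matrixOperator_apply] at h4
  rw [h4, ENNReal.ofReal_le_ofReal_iff (by positivity)] at h3
  exact le_of_sq_le_sq h3 (by positivity)

theorem isSelfAdjoint_matrixOperator (h : BoundedSums a) (hs : ∀ i k, a i k = a k i) :
    IsSelfAdjoint (matrixOperator a h) := by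
  classical
  rw [ContinuousLinearMap.isSelfAdjoint_iff']
  ext x i
  -- An entry is an inner product with a basis vector; the adjoint moves onto that vector and yields
  -- column `i`, which is row `i` by symmetry.
  have h1 : ContinuousLinearMap.adjoint (matrixOperator a h) x i
      = inner ℂ (lp.single 2 i (1 : ℂ)) (ContinuousLinearMap.adjoint (matrixOperator a h) x) := by
    rw [lp.inner_single_left]
    simp
  rw [h1, ContinuousLinearMap.adjoint_inner_right, lp.inner_eq_tsum, matrixOperator_apply]
  refine tsum_congr fun k => ?_
  rw [matrixOperator_single]
  simp [hs i k, mul_comm]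

end MatrixOperatorBounds

/-! ### Jacobi operators: rows, free case, eigenvalues -/

section Jacobi

variable {b a : ℕ → ℝ} {hb : ∃ B, ∀ j, |b j| ≤ B} {ha : ∃ A, ∀ j, |a j| ≤ A}

theorem jacobiOperator_apply_zero (x : Ell2 ℕ) :
    jacobiOperator b a hb ha x 0 = b 0 * x 0 + a 0 * x 1 := by
  rw [jacobiOperator, matrixOperator_apply, tsum_eq_sum (s := {0, 1})]
  · simp [jacobiMatrix]
  · intro k hk
    simp only [Finset.mem_insert, Finset.mem_singleton, not_or] at hk
    have : jacobiMatrix b a 0 k = 0 := by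
      unfold jacobiMatrix
      rw [if_neg (by omega), if_neg (by omega), if_neg (by omega)]
    simp [this]

theorem jacobiOperator_apply_succ (x : Ell2 ℕ) (k : ℕ) :
    jacobiOperator b a hb ha x (k + 1)
      = a k * x k + b (k + 1) * x (k + 1) + a (k + 1) * x (k + 2) := by
  rw [jacobiOperator, matrixOperator_apply, tsum_eq_sum (s := {k, k + 1, k + 2})]
  · simp [jacobiMatrix, add_assoc]
  · intro l hl
    simp only [Finset.mem_insert, Finset.mem_singleton, not_or] at hl
    have : jacobiMatrix b a (k + 1) l = 0 := by
      unfold jacobiMatrix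
      rw [if_neg (by omega), if_neg (by omega), if_neg (by omega)]
    simp [this]

theorem jacobiHead_apply_zero (μ s : ℝ) (x : Ell2 ℕ) :
    jacobiHead μ s x 0 = μ * x 0 + s * x 1 := by
  simp [jacobiHead, jacobiOperator_apply_zero]

theorem jacobiHead_apply_one (μ s : ℝ) (x : Ell2 ℕ) :
    jacobiHead μ s x 1 = s * x 0 + x 2 := by
  simp [jacobiHead, jacobiOperator_apply_succ x 0]

theorem jacobiHead_apply_add_two (μ s : ℝ) (x : Ell2 ℕ) (k : ℕ) :
    jacobiHead μ s x (k + 2) = x (k + 1) + x (k + 3) := by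
  simp [jacobiHead, jacobiOperator_apply_succ x (k + 1)]

theorem freeJacobi_apply_zero (x : Ell2 ℕ) : freeJacobi x 0 = x 1 := by
  simp [freeJacobi, jacobiOperator_apply_zero]

theorem freeJacobi_apply_succ (x : Ell2 ℕ) (k : ℕ) :
    freeJacobi x (k + 1) = x k + x (k + 2) := by
  simp [freeJacobi, jacobiOperator_apply_succ x k]

theorem freeJacobi_eq_jacobiHead : freeJacobi = jacobiHead 0 1 := by
  simp [freeJacobi, jacobiHead]

theorem norm_freeJacobi_le : ‖freeJacobi‖ ≤ 2 := by
  have h : ∀ i, ∑' k, ‖jacobiMatrix (fun _ => 0) (fun _ => 1) i k‖ₑ ≤ (2 : ℝ≥0) := by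
    intro i
    rcases i with _ | i
    · rw [tsum_eq_sum (s := {1})]
      · simp [jacobiMatrix]
      · intro k hk
        simp only [Finset.mem_singleton] at hk
        simp [jacobiMatrix, hk]
    · rw [tsum_eq_sum (s := {i, i + 2})]
      · simp [jacobiMatrix]
        norm_num
      · intro k hk
        simp only [Finset.mem_insert, Finset.mem_singleton, not_or] at hk
        have : ¬ (i = k) := fun h => hk.1 h.symm
        simp [jacobiMatrix, hk.2, this]
  refine norm_matrixOperator_le (C := 2) (boundedSums_jacobiMatrix _ _ ⟨0, by simp⟩ ⟨1, by simp⟩) h fun k => ?_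
  simpa only [fun i => jacobiMatrix_symm (fun _ => 0) (fun _ => 1) i k] using h k

theorem isSelfAdjoint_freeJacobi : IsSelfAdjoint freeJacobi :=
  isSelfAdjoint_matrixOperator (boundedSums_jacobiMatrix _ _ ⟨0, by simp⟩ ⟨1, by simp⟩) (jacobiMatrix_symm _ _)

theorem spectrum_freeJacobi_subset :
    spectrum ℂ freeJacobi ⊆ (fun x : ℝ => (x : ℂ)) '' Set.Icc (-2) 2 := by
  intro z hz
  have h1 := isSelfAdjoint_freeJacobi.mem_spectrum_eq_re hz
  have h2 : ‖z‖ ≤ 2 := by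
    refine (spectrum.norm_le_norm_mul_of_mem hz).trans ?_
    have := mul_le_mul norm_freeJacobi_le
      (ContinuousLinearMap.norm_id_le (𝕜 := ℂ) (E := Ell2 ℕ)) (norm_nonneg _) zero_le_two
    rwa [mul_one] at this
  refine ⟨z.re, abs_le.1 ((Complex.abs_re_le_norm z).trans h2), h1.symm⟩

/-- The sequence `s * x 0, x 1, x 2, …` satisfies a three-term recurrence wherever `x` satisfies
the eigenvalue equation of `jacobiHead μ s` beyond the first row. -/
def headTail (s : ℝ) (x : ℕ → ℂ) : ℕ → ℂ
  | 0 => s * x 0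
  | k + 1 => x (k + 1)

theorem headTail_recurrence {μ s : ℝ} {E : ℂ} {x : Ell2 ℕ}
    (h : ∀ k, jacobiHead μ s x (k + 1) = E * x (k + 1)) (k : ℕ) :
    headTail s x k + headTail s x (k + 2) = E * headTail s x (k + 1) := by
  cases k with
  | zero => simpa [headTail, jacobiHead_apply_one] using h 0
  | succ k => simpa [headTail, jacobiHead_apply_add_two] using h (k + 1)

theorem tendsto_headTail (s : ℝ) (x : Ell2 ℕ) :
    Filter.Tendsto (headTail s x) Filter.atTop (nhds 0) := by
  refine (Filter.tendsto_add_atTop_iff_nat 1).1 ?_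
  exact (Ell2.tendsto_zero x).comp (Filter.tendsto_add_atTop_nat 1)

/-- As `s ≠ 0`, the rows determine a solution from `x 0` alone. Hence eigenvalues are simple, and an
eigenvector has `x 0 ≠ 0`. -/
theorem eq_zero_of_jacobiHead_eq {μ s : ℝ} (hs : 0 < s) {E : ℂ} {x : Ell2 ℕ}
    (h : ∀ k, jacobiHead μ s x k = E * x k) (h0 : x 0 = 0) : x = 0 := by
  have hs' : (s : ℂ) ≠ 0 := Complex.ofReal_ne_zero.2 hs.ne'
  have h1 : x 1 = 0 := by
    have := h 0
    rw [jacobiHead_apply_zero, h0] at this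
    simpa [hs'] using this
  have key : ∀ k, x k = 0 ∧ x (k + 1) = 0 := by
    intro k
    induction k with
    | zero => exact ⟨h0, h1⟩
    | succ k ih =>
      refine ⟨ih.2, ?_⟩
      cases k with
      | zero => simpa [jacobiHead_apply_one, h0, h1] using h 1
      | succ k => simpa [jacobiHead_apply_add_two, ih.1, ih.2] using h (k + 2)
  ext k
  exact (key k).1

theorem mem_eigenspace_jacobiHead {μ s : ℝ} {E : ℂ} {x : Ell2 ℕ} :
    x ∈ Module.End.eigenspace (jacobiHead μ s : Ell2 ℕ →ₗ[ℂ] Ell2 ℕ) E ↔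
      ∀ k, jacobiHead μ s x k = E * x k := by
  rw [Module.End.mem_eigenspace_iff, ContinuousLinearMap.coe_coe, lp.ext_iff, funext_iff]
  simp

theorem finiteDimensional_eigenspace_jacobiHead (μ : ℝ) {s : ℝ} (hs : 0 < s) (E : ℂ) :
    FiniteDimensional ℂ (Module.End.eigenspace (jacobiHead μ s : Ell2 ℕ →ₗ[ℂ] Ell2 ℕ) E) := by
  refine FiniteDimensional.of_injective
    ((lp.evalCLM ℂ (fun _ : ℕ => ℂ) 2 0 : Ell2 ℕ →ₗ[ℂ] ℂ) ∘ₗ Submodule.subtype _)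
    ((injective_iff_map_eq_zero _).2 fun x hx => ?_)
  exact Subtype.ext (eq_zero_of_jacobiHead_eq hs (mem_eigenspace_jacobiHead.1 x.2) hx)

theorem finite_eigenvalues_jacobiHead (μ : ℝ) {s : ℝ} (hs : 0 < s) :
    {E : ℂ | Module.End.HasEigenvalue (jacobiHead μ s : Ell2 ℕ →ₗ[ℂ] Ell2 ℕ) E}.Finite := by
  have hs' : (s : ℂ) ≠ 0 := Complex.ofReal_ne_zero.2 hs.ne'
  -- `s ^ 2` times the invariant of `headTail s x`, after eliminating `x 1` by the first row `s * x
  -- 1 = (E - μ) * x 0`, is `P.eval E * x 0 ^ 2`.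
  let P : Polynomial ℂ := (Polynomial.X - Polynomial.C (μ : ℂ)) ^ 2
    - Polynomial.C ((s : ℂ) ^ 2) * (Polynomial.X * (Polynomial.X - Polynomial.C (μ : ℂ)))
    + Polynomial.C ((s : ℂ) ^ 4)
  -- The degree drops when `s = 1`, but the value at `μ` is always `s ^ 4`.
  have hP : P ≠ 0 := by
    intro h
    have h1 := congrArg (Polynomial.eval (μ : ℂ)) h
    simp [P, hs'] at h1
  refine (P.roots.toFinset.finite_toSet).subset fun E hE => ?_
  obtain ⟨x, hx⟩ := hE.exists_hasEigenvector
  have h1 := mem_eigenspace_jacobiHead.1 hx.1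
  have h0 : x 0 ≠ 0 := fun h => hx.2 (eq_zero_of_jacobiHead_eq hs h1 h)
  have h2 := three_term_invariant (headTail_recurrence fun k => h1 (k + 1)) (tendsto_headTail s x)
  have h3 := h1 0
  rw [jacobiHead_apply_zero] at h3
  simp only [headTail] at h2
  have h4 : P.eval E * x 0 ^ 2 = 0 := by
    simp only [P, Polynomial.eval_add, Polynomial.eval_sub, Polynomial.eval_mul,
      Polynomial.eval_pow, Polynomial.eval_X, Polynomial.eval_C]
    have h5 : (s : ℂ) * x 1 = (E - μ) * x 0 := by linear_combination h3
    linear_combination (s : ℂ) ^ 2 * h2 - ((s : ℂ) * x 1 + (E - μ) * x 0 - s ^ 2 * E * x 0) * h5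
  have h5 : P.eval E = 0 := (mul_eq_zero.1 h4).resolve_right (pow_ne_zero _ h0)
  simpa [hP] using h5

end Jacobi

/-! ### Spectra of the Jacobi operators -/

section JacobiSpectrum

theorem ContinuousLinearMap.mem_spectrum_iff_not_bijective {H : Type*} [NormedAddCommGroup H]
    [NormedSpace ℂ H] [CompleteSpace H] (T : H →L[ℂ] H) (z : ℂ) :
    z ∈ spectrum ℂ T ↔ ¬ Function.Bijective fun x => z • x - T x := by
  rw [spectrum.mem_iff, ContinuousLinearMap.isUnit_iff_bijective]
  rfl

theorem hasEigenvalue_mem_spectrum {H : Type*} [NormedAddCommGroup H]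
    [NormedSpace ℂ H] [CompleteSpace H] {T : H →L[ℂ] H} {z : ℂ}
    (h : Module.End.HasEigenvalue (T : H →ₗ[ℂ] H) z) : z ∈ spectrum ℂ T := by
  obtain ⟨x, hx⟩ := h.exists_hasEigenvector
  rw [T.mem_spectrum_iff_not_bijective]
  intro hb
  refine hx.2 (hb.1 ?_)
  have := hx.apply_eq_smul
  simp only [ContinuousLinearMap.coe_coe] at this
  simp [this]

/-- For `|E| < 2` the first basis vector has no preimage under `E - J`: a preimage solves the
recurrence beyond row `0`, so its first two entries vanish and row `0` reads `0 = 1`. The endpoints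
follow because the spectrum is closed. -/
theorem Icc_subset_spectrum_jacobiHead (μ : ℝ) {s : ℝ} (hs : 0 < s) :
    (fun x : ℝ => (x : ℂ)) '' Set.Icc (-2) 2 ⊆ spectrum ℂ (jacobiHead μ s) := by
  have h1 : Set.Ioo (-2) 2 ⊆ (fun x : ℝ => (x : ℂ)) ⁻¹' spectrum ℂ (jacobiHead μ s) := by
    intro E hE
    rw [Set.mem_preimage, ContinuousLinearMap.mem_spectrum_iff_not_bijective]
    intro hb
    obtain ⟨x, hx⟩ := hb.2 (lp.single 2 0 1)
    have h2 : ∀ k, E * x k - jacobiHead μ s x k = (lp.single 2 0 1 : Ell2 ℕ) k := by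
      intro k
      rw [← hx]
      rfl
    have h3 : ∀ k, jacobiHead μ s x (k + 1) = E * x (k + 1) := by
      intro k
      have := h2 (k + 1)
      rw [lp.single_apply, Pi.single_eq_of_ne (by omega)] at this
      exact (sub_eq_zero.1 this).symm
    obtain ⟨h4, h5⟩ := three_term_complex_eq_zero (abs_lt.2 hE) (headTail_recurrence h3)
      (tendsto_headTail s x)
    have h6 : x 0 = 0 := by simpa [headTail, hs.ne'] using h4
    have h7 : x 1 = 0 := h5
    have h8 := h2 0
    rw [jacobiHead_apply_zero, h6, h7] at h8
    simp at h8
  rw [Set.image_subset_iff, ← closure_Ioo (by norm_num)]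
  exact closure_minimal h1 ((spectrum.isClosed _).preimage Complex.continuous_ofReal)

theorem isCompactOperator_jacobiHead_sub_freeJacobi (μ s : ℝ) :
    IsCompactOperator (jacobiHead μ s - freeJacobi) := by
  let e (k : ℕ) : Ell2 ℕ →L[ℂ] ℂ := lp.evalCLM ℂ (fun _ : ℕ => ℂ) 2 k
  let φ₀ : Ell2 ℕ →L[ℂ] ℂ := (μ : ℂ) • e 0 + ((s : ℂ) - 1) • e 1
  let φ₁ : Ell2 ℕ →L[ℂ] ℂ := ((s : ℂ) - 1) • e 0
  have h : jacobiHead μ s - freeJacobi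
      = φ₀.smulRight (lp.single 2 0 1 : Ell2 ℕ) + φ₁.smulRight (lp.single 2 1 1 : Ell2 ℕ) := by
    ext x k
    have he : ∀ k, e k x = x k := fun _ => rfl
    have h0 : (φ₀.smulRight (lp.single 2 0 1 : Ell2 ℕ)
        + φ₁.smulRight (lp.single 2 1 1 : Ell2 ℕ)) x k
        = (μ * x 0 + (s - 1) * x 1) * (lp.single 2 0 1 : Ell2 ℕ) k
          + ((s - 1) * x 0) * (lp.single 2 1 1 : Ell2 ℕ) k := by
      rfl
    rw [h0]
    change jacobiHead μ s x k - freeJacobi x k = _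
    rcases k with _ | _ | k
    · simp [jacobiHead_apply_zero, freeJacobi_apply_zero, lp.single_apply]
      ring
    · simp [jacobiHead_apply_one, freeJacobi_apply_succ, lp.single_apply]
      ring
    · simp [jacobiHead_apply_add_two, freeJacobi_apply_succ, lp.single_apply]
  have hc : ∀ (φ : Ell2 ℕ →L[ℂ] ℂ) (v : Ell2 ℕ), IsCompactOperator (φ.smulRight v) := fun φ v =>
    (isCompactOperator_of_locallyCompactSpace_dom φ).clm_comp
      (ContinuousLinearMap.toSpanSingleton ℂ v)
  rw [h]
  exact (hc _ _).add (hc _ _)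

/-- Weyl's theorem on compact perturbations: outside the spectrum of `S`, the spectrum of `T`
consists of eigenvalues. -/
theorem hasEigenvalue_of_isCompactOperator_sub {H : Type*} [NormedAddCommGroup H]
    [NormedSpace ℂ H] [CompleteSpace H] {S T : H →L[ℂ] H} (hc : IsCompactOperator (T - S)) {z : ℂ}
    (hS : z ∉ spectrum ℂ S) (hT : z ∈ spectrum ℂ T) :
    Module.End.HasEigenvalue (T : H →ₗ[ℂ] H) z := by
  obtain ⟨u, hu⟩ := spectrum.notMem_iff.1 hS
  -- Fredholm alternative at `1` for `R = (z - S)⁻¹ (T - S)`, since `z - T = (z - S) (1 - R)`.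
  have hR : IsCompactOperator ((↑u⁻¹ : H →L[ℂ] H) * (T - S)) := hc.clm_comp _
  rcases hR.hasEigenvalue_or_mem_resolventSet (μ := 1) one_ne_zero with h | h
  · obtain ⟨x, hx⟩ := h.exists_hasEigenvector
    refine Module.End.hasEigenvalue_of_hasEigenvector (x := x) ⟨?_, hx.2⟩
    have h1 := hx.apply_eq_smul
    simp only [ContinuousLinearMap.coe_coe, one_smul] at h1
    have h2 : (T - S) x = (u : H →L[ℂ] H) x := by
      conv_rhs => rw [← h1]
      rw [← mul_apply_eq_comp, ← mul_assoc, Units.mul_inv, one_mul]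
    rw [hu] at h2
    rw [Module.End.mem_eigenspace_iff, ContinuousLinearMap.coe_coe]
    have h3 : T x - S x = z • x - S x := h2
    exact sub_left_injective h3
  · refine absurd hT (spectrum.notMem_iff.2 ?_)
    have h1 : algebraMap ℂ (H →L[ℂ] H) z - T
        = u * (algebraMap ℂ (H →L[ℂ] H) 1 - (↑u⁻¹ : H →L[ℂ] H) * (T - S)) := by
      rw [mul_sub, ← mul_assoc, Units.mul_inv, one_mul, map_one, mul_one, hu]
      abel
    rw [h1]
    exact u.isUnit.mul h

theorem spectrum_jacobiHead (μ : ℝ) {s : ℝ} (hs : 0 < s) :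
    spectrum ℂ (jacobiHead μ s)
      = (fun x : ℝ => (x : ℂ)) '' Set.Icc (-2) 2 ∪ discreteSpectrum (jacobiHead μ s) := by
  refine Set.Subset.antisymm (fun z hz => ?_) (Set.union_subset
    (Icc_subset_spectrum_jacobiHead μ hs) fun z hz => hasEigenvalue_mem_spectrum hz.1)
  by_cases hz' : z ∈ (fun x : ℝ => (x : ℂ)) '' Set.Icc (-2) 2
  · exact .inl hz'
  have key : ∀ w ∈ spectrum ℂ (jacobiHead μ s), w ∉ (fun x : ℝ => (x : ℂ)) '' Set.Icc (-2) 2 →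
      Module.End.HasEigenvalue (jacobiHead μ s : Ell2 ℕ →ₗ[ℂ] Ell2 ℕ) w := fun w hw hw' =>
    hasEigenvalue_of_isCompactOperator_sub (isCompactOperator_jacobiHead_sub_freeJacobi μ s)
      (fun h => hw' (spectrum_freeJacobi_subset h)) hw
  refine .inr ⟨key z hz hz', finiteDimensional_eigenspace_jacobiHead μ hs z, fun hacc => ?_⟩
  have hclosed : IsClosed ((fun x : ℝ => (x : ℂ)) '' Set.Icc (-2) 2) :=
    (isCompact_Icc.image Complex.continuous_ofReal).isClosed
  -- The spectrum lies in a closed interval missing `z` together with a finite set; neither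
  -- accumulates at `z`.
  have h1 : AccPt z (Filter.principal
      ((fun x : ℝ => (x : ℂ)) '' Set.Icc (-2) 2 ∪
        {E : ℂ | Module.End.HasEigenvalue (jacobiHead μ s : Ell2 ℕ →ₗ[ℂ] Ell2 ℕ) E})) := by
    refine hacc.mono (Filter.principal_mono.2 fun w hw => ?_)
    by_cases hw' : w ∈ (fun x : ℝ => (x : ℂ)) '' Set.Icc (-2) 2
    · exact .inl hw'
    · exact .inr (key w hw hw')
  rw [← Filter.sup_principal, accPt_sup] at h1
  rcases h1 with h1 | h1
  · exact hz' (hclosed.closure_subset (mem_closure_iff_clusterPt.2 h1.clusterPt))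
  · exact Set.Infinite.of_accPt h1 (finite_eigenvalues_jacobiHead μ hs)

theorem spectrum_freeJacobi :
    spectrum ℂ freeJacobi = (fun x : ℝ => (x : ℂ)) '' Set.Icc (-2) 2 := by
  refine Set.Subset.antisymm spectrum_freeJacobi_subset ?_
  rw [freeJacobi_eq_jacobiHead]
  exact Icc_subset_spectrum_jacobiHead 0 one_pos

end JacobiSpectrum

/-! ### Orthogonal matrices: diagonalization and extension -/

section OrthogonalMatrices

theorem sum_enorm_sq_mul {ι κ : Type*} [Fintype ι] [Fintype κ] [DecidableEq ι]
    {W : Matrix κ ι ℝ} (h : W.transpose * W = 1) (x : ι → ℂ) :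
    ∑ k, ‖∑ i, (W k i : ℂ) * x i‖ₑ ^ 2 = ∑ i, ‖x i‖ₑ ^ 2 := by
  have hW : ∀ i l, ∑ k, (W k i : ℂ) * (W k l : ℂ) = if i = l then 1 else 0 := by
    intro i l
    have := congrFun (congrFun h i) l
    rw [Matrix.mul_apply, Matrix.one_apply] at this
    simp only [Matrix.transpose_apply] at this
    simpa [apply_ite] using congrArg Complex.ofReal this
  have hsq : ∀ z : ℂ, ‖z‖ₑ ^ 2 = ENNReal.ofReal (‖z‖ ^ 2) := fun z => by
    rw [ENNReal.ofReal_pow (norm_nonneg _), ofReal_norm]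
  simp only [hsq]
  rw [← ENNReal.ofReal_sum_of_nonneg fun _ _ => by positivity,
    ← ENNReal.ofReal_sum_of_nonneg fun _ _ => by positivity]
  congr 1
  have hc : ∀ z : ℂ, ((‖z‖ ^ 2 : ℝ) : ℂ) = z * (starRingEnd ℂ) z := fun z => by
    rw [Complex.mul_conj']
    norm_cast
  apply Complex.ofReal_injective
  rw [Complex.ofReal_sum, Complex.ofReal_sum]
  simp only [hc, map_sum, map_mul, Complex.conj_ofReal, Finset.sum_mul_sum]
  calc ∑ k, ∑ i, ∑ l, (W k i : ℂ) * x i * ((W k l : ℂ) * (starRingEnd ℂ) (x l))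
      = ∑ i, ∑ l, (∑ k, (W k i : ℂ) * (W k l : ℂ)) * (x i * (starRingEnd ℂ) (x l)) := by
        rw [Finset.sum_comm]
        refine Finset.sum_congr rfl fun i _ => ?_
        rw [Finset.sum_comm]
        refine Finset.sum_congr rfl fun l _ => ?_
        rw [Finset.sum_mul]
        exact Finset.sum_congr rfl fun k _ => by ring
    _ = ∑ i, x i * (starRingEnd ℂ) (x i) := by
        simp [hW]

theorem sum_mul_sum_transpose {ι κ : Type*} [Fintype ι] [Fintype κ] [DecidableEq κ]
    {W : Matrix κ ι ℝ} (h : W * W.transpose = 1) (y : κ → ℂ) (k : κ) :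
    ∑ i, (W k i : ℂ) * ∑ l, (W l i : ℂ) * y l = y k := by
  have hW : ∀ l, ∑ i, (W k i : ℂ) * (W l i : ℂ) = if k = l then 1 else 0 := by
    intro l
    have := congrFun (congrFun h k) l
    rw [Matrix.mul_apply, Matrix.one_apply] at this
    simp only [Matrix.transpose_apply] at this
    simpa [apply_ite] using congrArg Complex.ofReal this
  simp only [Finset.mul_sum]
  rw [Finset.sum_comm]
  calc ∑ l, ∑ i, (W k i : ℂ) * ((W l i : ℂ) * y l)
      = ∑ l, (∑ i, (W k i : ℂ) * (W l i : ℂ)) * y l := by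
        refine Finset.sum_congr rfl fun l _ => ?_
        rw [Finset.sum_mul]
        exact Finset.sum_congr rfl fun i _ => by ring
    _ = y k := by simp [hW]

/-- Equal multisets of values mean fibres of equal size. This matches the prescribed list of
eigenvalues with the one indexing the eigenvector basis. -/
theorem exists_equiv_of_map_univ_eq {ι κ α : Type*} [Fintype ι] [Fintype κ] {f : ι → α} {g : κ → α}
    (h : Multiset.map f Finset.univ.val = Multiset.map g Finset.univ.val) :
    ∃ e : ι ≃ κ, ∀ i, g (e i) = f i := by
  classical
  have hcard : ∀ a, Fintype.card {i // f i = a} = Fintype.card {k // g k = a} := by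
    intro a
    have := congrArg (Multiset.count a) h
    rw [Multiset.count_map, Multiset.count_map] at this
    simpa [Fintype.card_subtype, Finset.card_def, Finset.filter_val, eq_comm] using this
  exact ⟨Equiv.ofFiberEquiv fun a => Fintype.equivOfCardEq (hcard a),
    fun i => Equiv.ofFiberEquiv_map _ i⟩

/-- A real symmetric matrix is diagonalized by an orthogonal matrix, its eigenvalues being taken
in any prescribed order. -/
theorem Matrix.exists_orthogonal_diagonalization {V J : Type*} [Fintype V] [DecidableEq V]
    [Fintype J] [DecidableEq J] {M : Matrix V V ℝ} (hM : ∀ u v, M u v = M v u) (eig : J → ℝ)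
    (heig : M.charpoly = ∏ j, (Polynomial.X - Polynomial.C (eig j))) :
    ∃ B : Matrix J V ℝ, B * B.transpose = 1 ∧ B.transpose * B = 1 ∧
      ∀ j v, ∑ u, B j u * M u v = eig j * B j v := by
  have hH : M.IsHermitian := Matrix.IsHermitian.ext fun u v => by simp [hM u v]
  have h1 := hH.roots_charpoly_eq_eigenvalues
  rw [heig, Polynomial.roots_prod _ _
    (Finset.prod_ne_zero_iff.2 fun j _ => Polynomial.X_sub_C_ne_zero _)] at h1
  simp only [Polynomial.roots_X_sub_C, Multiset.bind_singleton] at h1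
  obtain ⟨e, he⟩ := exists_equiv_of_map_univ_eq h1
  have hB : (Matrix.of fun j v => hH.eigenvectorBasis (e j) v : Matrix J V ℝ)
      * (Matrix.of fun j v => hH.eigenvectorBasis (e j) v : Matrix J V ℝ).transpose = 1 := by
    ext j k
    have := orthonormal_iff_ite.1 hH.eigenvectorBasis.orthonormal (e k) (e j)
    rw [PiLp.inner_apply] at this
    simpa [Matrix.mul_apply, Matrix.one_apply, eq_comm] using this
  refine ⟨_, hB, (Matrix.mul_eq_one_comm_of_equiv e).1 hB, fun j v => ?_⟩
  have h2 := congrFun (hH.mulVec_eigenvectorBasis (e j)) v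
  have h3 : hH.eigenvalues (e j) = eig j := by simpa using he j
  rw [h3] at h2
  simp only [Matrix.mulVec, dotProduct, Pi.smul_apply, smul_eq_mul] at h2
  simp only [Matrix.of_apply]
  rw [← h2]
  exact Finset.sum_congr rfl fun u _ => by rw [hM u v, mul_comm]

/-- The rows `B j v / √p` of length `|V| p` extend to an orthogonal matrix. -/
theorem Matrix.exists_orthogonal_extension {V J C : Type*} [Fintype V] [DecidableEq V]
    [Fintype J] [DecidableEq J] [Fintype C] [DecidableEq C] {p : ℕ} (hp : 1 ≤ p)
    (hcard : Fintype.card (J ⊕ C) = Fintype.card (V × Fin p))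
    {B : Matrix J V ℝ} (hB : B * B.transpose = 1) (hB' : B.transpose * B = 1) :
    ∃ W : Matrix (J ⊕ C) (V × Fin p) ℝ, W * W.transpose = 1 ∧ W.transpose * W = 1 ∧
      (∀ j v i, √(p : ℝ) * W (.inl j) (v, i) = B j v) ∧
      ∀ c v, ∑ i, W (.inr c) (v, i) = 0 := by
  have hp' : (0 : ℝ) < p := by exact_mod_cast hp
  have hs : √(p : ℝ) ≠ 0 := (Real.sqrt_pos.2 hp').ne'
  have hBi : ∀ j k, ∑ v, B j v * B k v = if j = k then 1 else 0 := by
    intro j k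
    have := congrFun (congrFun hB j) k
    rwa [Matrix.mul_apply, Matrix.one_apply] at this
  let w : J ⊕ C → EuclideanSpace ℝ (V × Fin p) := fun t => WithLp.toLp 2 fun q =>
    Sum.elim (fun j => B j q.1 / √(p : ℝ)) (fun _ => 0) t
  have hw : ∀ j k, inner ℝ (w (.inl j)) (w (.inl k)) = if j = k then (1 : ℝ) else 0 := by
    intro j k
    rw [PiLp.inner_apply, Fintype.sum_prod_type]
    simp only [w, Sum.elim_inl, RCLike.inner_apply, conj_trivial, Finset.sum_const,
      Finset.card_univ, Fintype.card_fin, nsmul_eq_mul]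
    rw [← hBi]
    refine Finset.sum_congr rfl fun v _ => ?_
    rw [div_mul_div_comm, Real.mul_self_sqrt hp'.le]
    field_simp
  have hon : Orthonormal ℝ ((Set.range (Sum.inl : J → J ⊕ C)).domRestrict w) := by
    rw [orthonormal_iff_ite]
    rintro ⟨_, j, rfl⟩ ⟨_, k, rfl⟩
    rw [Set.domRestrict_apply, Set.domRestrict_apply, hw]
    simp [Subtype.ext_iff]
  obtain ⟨b, hb⟩ := hon.exists_orthonormalBasis_extension_of_card_eq (by
    rw [finrank_euclideanSpace, hcard])
  have hW : (Matrix.of fun t q => b t q : Matrix (J ⊕ C) (V × Fin p) ℝ)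
      * (Matrix.of fun t q => b t q : Matrix (J ⊕ C) (V × Fin p) ℝ).transpose = 1 := by
    ext t r
    have := orthonormal_iff_ite.1 b.orthonormal r t
    rw [PiLp.inner_apply] at this
    simpa [Matrix.mul_apply, Matrix.one_apply, eq_comm] using this
  have hl : ∀ j v i, b (.inl j) (v, i) = B j v / √(p : ℝ) := by
    intro j v i
    rw [hb _ ⟨j, rfl⟩]
    rfl
  refine ⟨_, hW, (Matrix.mul_eq_one_comm_of_equiv (Fintype.equivOfCardEq hcard)).1 hW,
    fun j v i => ?_, fun c v => ?_⟩
  · rw [Matrix.of_apply, hl]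
    field_simp
  -- Row `c` is orthogonal to every row `B j v / √p`, so `B` kills its sums over the rays at each
  -- vertex; `B` is invertible.
  · have h1 : B.mulVec (fun v => ∑ i, b (.inr c) (v, i)) = 0 := by
      ext j
      have h2 := orthonormal_iff_ite.1 b.orthonormal (.inr c) (.inl j)
      rw [PiLp.inner_apply, Fintype.sum_prod_type] at h2
      simp only [hl, RCLike.inner_apply, conj_trivial, reduceCtorEq, if_false] at h2
      simp only [div_mul_eq_mul_div, ← Finset.sum_div, ← Finset.mul_sum] at h2
      exact (div_eq_zero_iff.1 h2).resolve_right hs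
    have h3 := congrArg B.transpose.mulVec h1
    rw [Matrix.mulVec_mulVec, hB', Matrix.one_mulVec, Matrix.mulVec_zero] at h3
    exact congrFun h3 v

end OrthogonalMatrices

/-! ### Rows of the adjacency operator of `Γ` -/

section SunOperator

variable {V : Type*} [Fintype V] (G : WeightedGraph V) (p : ℕ)

theorem WeightedGraph.sunOperator_apply (x : Ell2 (V ⊕ (V × Fin p × ℕ)))
    (r : V ⊕ (V × Fin p × ℕ)) :
    G.sunOperator p x r = ∑ u, ((G.sun p).adjMatrix r (.inl u) : ℂ) * x (.inl u)
      + ∑' q, ((G.sun p).adjMatrix r (.inr q) : ℂ) * x (.inr q) := by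
  have h := (G.boundedSums_sun p).summable x r
  rw [WeightedGraph.sunOperator, matrixOperator_apply,
    Summable.tsum_sum (h.comp_injective Sum.inl_injective) (h.comp_injective Sum.inr_injective),
    tsum_fintype]

theorem WeightedGraph.sunOperator_apply_inl (x : Ell2 (V ⊕ (V × Fin p × ℕ))) (v : V) :
    G.sunOperator p x (.inl v) = ∑ u, (G.adjMatrix v u : ℂ) * x (.inl u)
      + ∑ i, x (.inr (v, i, 0)) := by
  rw [G.sunOperator_apply]
  congr 1
  have hinj : Function.Injective fun i : Fin p => (v, i, 0) := fun i k h => by simpa using h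
  rw [tsum_eq_sum (s := Finset.univ.map ⟨_, hinj⟩), Finset.sum_map]
  · refine Finset.sum_congr rfl fun i _ => ?_
    rw [Function.Embedding.coeFn_mk]
    simp [WeightedGraph.adjMatrix, WeightedGraph.sun, WeightedGraph.sunAdj,
      WeightedGraph.sunWeight]
  · rintro ⟨u, i, k⟩ h
    have : ¬ (v = u ∧ k = 0) := by
      rintro ⟨rfl, rfl⟩
      exact h (Finset.mem_map_of_mem _ (Finset.mem_univ i))
    simp [WeightedGraph.adjMatrix, WeightedGraph.sun, WeightedGraph.sunAdj, this]

theorem WeightedGraph.sunOperator_apply_inr_zero (x : Ell2 (V ⊕ (V × Fin p × ℕ))) (v : V)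
    (i : Fin p) :
    G.sunOperator p x (.inr (v, i, 0)) = x (.inl v) + x (.inr (v, i, 1)) := by
  rw [G.sunOperator_apply]
  congr 1
  · rw [Fintype.sum_eq_single v]
    · simp [WeightedGraph.adjMatrix, WeightedGraph.sun, WeightedGraph.sunAdj,
        WeightedGraph.sunWeight]
    · intro u hu
      simp [WeightedGraph.adjMatrix, WeightedGraph.sun, WeightedGraph.sunAdj, hu]
  · rw [tsum_eq_single (v, i, 1)]
    · simp [WeightedGraph.adjMatrix, WeightedGraph.sun, WeightedGraph.sunAdj,
        WeightedGraph.sunWeight]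
    · rintro ⟨u, l, k⟩ h
      have : ¬ (v = u ∧ i = l ∧ k = 1) := by
        rintro ⟨rfl, rfl, rfl⟩
        exact h rfl
      simp [WeightedGraph.adjMatrix, WeightedGraph.sun, WeightedGraph.sunAdj, this]

theorem WeightedGraph.sunOperator_apply_inr_succ (x : Ell2 (V ⊕ (V × Fin p × ℕ))) (v : V)
    (i : Fin p) (k : ℕ) :
    G.sunOperator p x (.inr (v, i, k + 1)) = x (.inr (v, i, k)) + x (.inr (v, i, k + 2)) := by
  classical
  rw [G.sunOperator_apply, Finset.sum_eq_zero, zero_add]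
  · rw [tsum_eq_sum (s := {(v, i, k), (v, i, k + 2)}), Finset.sum_pair (by simp)]
    · simp [WeightedGraph.adjMatrix, WeightedGraph.sun, WeightedGraph.sunAdj,
        WeightedGraph.sunWeight]
    · rintro ⟨u, l, m⟩ h
      have : ¬ (v = u ∧ i = l ∧ (m = k + 1 + 1 ∨ k + 1 = m + 1)) := by
        rintro ⟨rfl, rfl, rfl | h'⟩
        · exact h (by simp)
        · obtain rfl : k = m := by omega
          exact h (by simp)
      have h0 : (G.sun p).adjMatrix (.inr (v, i, k + 1)) (.inr (u, l, m)) = 0 := if_neg this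
      simp [h0]
  · intro u _
    have h0 : (G.sun p).adjMatrix (.inr (v, i, k + 1)) (.inl u) = 0 :=
      if_neg fun h => Nat.succ_ne_zero _ h.2
    simp [h0]

end SunOperator

/-! ### The unitary change of coordinates -/

section Decomposition

variable {V J C : Type*} {p : ℕ}

/-- Drops the first entry of each of the sequences `y (.inl j)`. -/
def dropHeads (y : J ⊕ C → ℕ → ℂ) : J ⊕ C → ℕ → ℂ
  | .inl j, k => y (.inl j) (k + 1)
  | .inr c, k => y (.inr c) k

/-- The change of coordinates that acts by the matrix `B` on the vertices of the finite graph,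
and by the matrix `W` on each level of the rays. -/
noncomputable def sunToRays [Fintype V] (B : Matrix J V ℝ) (W : Matrix (J ⊕ C) (V × Fin p) ℝ)
    (x : V ⊕ (V × Fin p × ℕ) → ℂ) : J ⊕ C → ℕ → ℂ
  | .inl j, 0 => ∑ v, (B j v : ℂ) * x (.inl v)
  | .inl j, k + 1 => ∑ q, (W (.inl j) q : ℂ) * x (.inr (q.1, q.2, k))
  | .inr c, k => ∑ q, (W (.inr c) q : ℂ) * x (.inr (q.1, q.2, k))

/-- The inverse of `sunToRays`. -/
noncomputable def raysToSun [Fintype J] [Fintype C] (B : Matrix J V ℝ)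
    (W : Matrix (J ⊕ C) (V × Fin p) ℝ) (y : J ⊕ C → ℕ → ℂ) : V ⊕ (V × Fin p × ℕ) → ℂ
  | .inl v => ∑ j, (B j v : ℂ) * y (.inl j) 0
  | .inr (v, i, k) => ∑ t, (W t (v, i) : ℂ) * dropHeads y t k

/-- In an `.inl` sequence entry `0` belongs to `G` and level `k` of the rays is entry `k + 1`; in an
`.inr` sequence it is entry `k`. `dropHeads` removes this offset, so that `W` acts alike on all
rows. -/
theorem dropHeads_sunToRays [Fintype V] (B : Matrix J V ℝ) (W : Matrix (J ⊕ C) (V × Fin p) ℝ)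
    (x : V ⊕ (V × Fin p × ℕ) → ℂ) (t : J ⊕ C) (k : ℕ) :
    dropHeads (sunToRays B W x) t k = ∑ q, (W t q : ℂ) * x (.inr (q.1, q.2, k)) := by
  rcases t with j | c <;> rfl

theorem rays_ext {y z : J ⊕ C → ℕ → ℂ} (h0 : ∀ j, y (.inl j) 0 = z (.inl j) 0)
    (h : ∀ t k, dropHeads y t k = dropHeads z t k) : y = z := by
  ext t k
  rcases t with j | c
  · cases k with
    | zero => exact h0 j
    | succ k => exact h (.inl j) k
  · exact h (.inr c) k

theorem sunToRays_raysToSun [Fintype V] [Fintype J] [DecidableEq J] [Fintype C] [DecidableEq C]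
    {B : Matrix J V ℝ} {W : Matrix (J ⊕ C) (V × Fin p) ℝ} (hB : B * B.transpose = 1)
    (hW : W * W.transpose = 1) (y : J ⊕ C → ℕ → ℂ) : sunToRays B W (raysToSun B W y) = y := by
  refine rays_ext (fun j => ?_) fun t k => ?_
  · exact sum_mul_sum_transpose hB (fun j => y (.inl j) 0) j
  · rw [dropHeads_sunToRays]
    exact sum_mul_sum_transpose hW (fun t => dropHeads y t k) t

/-- Has the same shape as `tsum_enorm_sq_sun`, so the norms can be compared level by level. Sums in
`ℝ≥0∞` rearrange without summability conditions. -/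
theorem sum_tsum_enorm_sq_rays [Fintype J] [Fintype C] (y : J ⊕ C → ℕ → ℂ) :
    ∑ t, ∑' k, ‖y t k‖ₑ ^ 2 = ∑ j, ‖y (.inl j) 0‖ₑ ^ 2 + ∑' k, ∑ t, ‖dropHeads y t k‖ₑ ^ 2 := by
  rw [Summable.tsum_finsetSum fun _ _ => ENNReal.summable, Fintype.sum_sum_type,
    Fintype.sum_sum_type, ← add_assoc, ← Finset.sum_add_distrib]
  congr 1
  exact Finset.sum_congr rfl fun j _ => tsum_eq_zero_add' ENNReal.summable

theorem tsum_enorm_sq_sun [Fintype V] (x : V ⊕ (V × Fin p × ℕ) → ℂ) :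
    ∑' r, ‖x r‖ₑ ^ 2 = ∑ v, ‖x (.inl v)‖ₑ ^ 2
      + ∑' k, ∑ q : V × Fin p, ‖x (.inr (q.1, q.2, k))‖ₑ ^ 2 := by
  rw [Summable.tsum_sum ENNReal.summable ENNReal.summable, tsum_fintype]
  congr 1
  rw [← (Equiv.prodAssoc V (Fin p) ℕ).tsum_eq, ENNReal.tsum_prod', ENNReal.tsum_comm]
  exact tsum_congr fun k => tsum_fintype _

theorem tsum_enorm_sq_sunToRays [Fintype V] [DecidableEq V] [Fintype J] [Fintype C]
    {B : Matrix J V ℝ} {W : Matrix (J ⊕ C) (V × Fin p) ℝ} (hB : B.transpose * B = 1)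
    (hW : W.transpose * W = 1) (x : V ⊕ (V × Fin p × ℕ) → ℂ) :
    ∑ t, ∑' k, ‖sunToRays B W x t k‖ₑ ^ 2 = ∑' r, ‖x r‖ₑ ^ 2 := by
  rw [sum_tsum_enorm_sq_rays, tsum_enorm_sq_sun]
  congr 1
  · exact sum_enorm_sq_mul hB fun v => x (.inl v)
  · refine tsum_congr fun k => ?_
    simp only [dropHeads_sunToRays]
    exact sum_enorm_sq_mul hW fun q => x (.inr (q.1, q.2, k))

theorem memℓp_two_of_tsum_enorm_sq {ι : Type*} {x : ι → ℂ} (h : ∑' i, ‖x i‖ₑ ^ 2 ≠ ⊤) :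
    Memℓp x 2 := by
  refine memℓp_gen ?_
  simpa using ENNReal.summable_toReal h

theorem tsum_enorm_sq_ne_top {ι : Type*} (x : Ell2 ι) : ∑' i, ‖x i‖ₑ ^ 2 ≠ ⊤ := by
  rw [tsum_enorm_sq]
  exact ENNReal.ofReal_ne_top

theorem PiLp.sum_tsum_enorm_sq {I : Type*} [Fintype I] (y : PiLp 2 fun _ : I => Ell2 ℕ) :
    ∑ t, ∑' k, ‖y t k‖ₑ ^ 2 = ENNReal.ofReal (‖y‖ ^ 2) := by
  rw [PiLp.norm_sq_eq_of_L2, ENNReal.ofReal_sum_of_nonneg fun _ _ => by positivity]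
  exact Finset.sum_congr rfl fun t _ => tsum_enorm_sq (y t)

/-- The change of coordinates `sunToRays`, as a unitary operator. -/
theorem exists_linearIsometryEquiv_sunToRays [Fintype V] [DecidableEq V] [Fintype J]
    [DecidableEq J] [Fintype C] [DecidableEq C] {B : Matrix J V ℝ}
    {W : Matrix (J ⊕ C) (V × Fin p) ℝ} (hB : B * B.transpose = 1) (hB' : B.transpose * B = 1)
    (hW : W * W.transpose = 1) (hW' : W.transpose * W = 1) :
    ∃ U : Ell2 (V ⊕ (V × Fin p × ℕ)) ≃ₗᵢ[ℂ] PiLp 2 (fun _ : J ⊕ C => Ell2 ℕ),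
      ∀ x t k, U x t k = sunToRays B W x t k := by
  have hmem : ∀ (x : Ell2 (V ⊕ (V × Fin p × ℕ))) (t : J ⊕ C), Memℓp (sunToRays B W x t) 2 := by
    intro x t
    refine memℓp_two_of_tsum_enorm_sq (ne_top_of_le_ne_top (tsum_enorm_sq_ne_top x) ?_)
    rw [← tsum_enorm_sq_sunToRays hB' hW' x]
    exact Finset.single_le_sum (f := fun t => ∑' k, ‖sunToRays B W x t k‖ₑ ^ 2)
      (fun _ _ => zero_le) (Finset.mem_univ t)
  let F : Ell2 (V ⊕ (V × Fin p × ℕ)) →ₗ[ℂ] PiLp 2 (fun _ : J ⊕ C => Ell2 ℕ) :=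
    { toFun := fun x => WithLp.toLp 2 fun t => ⟨sunToRays B W x t, hmem x t⟩
      map_add' := fun x z => by
        ext t k
        change sunToRays B W (x + z : Ell2 _) t k = sunToRays B W x t k + sunToRays B W z t k
        rcases t with j | c
        · cases k <;> simp [sunToRays, mul_add, Finset.sum_add_distrib]
        · simp [sunToRays, mul_add, Finset.sum_add_distrib]
      map_smul' := fun a x => by
        ext t k
        change sunToRays B W (a • x : Ell2 _) t k = a * sunToRays B W x t k
        rcases t with j | c
        · cases k <;> simp [sunToRays, mul_left_comm, Finset.mul_sum]
        · simp [sunToRays, mul_left_comm, Finset.mul_sum] }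
  have hF : ∀ x t k, F x t k = sunToRays B W x t k := fun _ _ _ => rfl
  have hnorm : ∀ x, ‖F x‖ = ‖x‖ := by
    intro x
    have h1 := tsum_enorm_sq_sunToRays hB' hW' x
    simp only [← hF] at h1
    rw [PiLp.sum_tsum_enorm_sq, tsum_enorm_sq,
      ENNReal.ofReal_eq_ofReal_iff (by positivity) (by positivity)] at h1
    exact (sq_eq_sq₀ (norm_nonneg _) (norm_nonneg _)).1 h1
  have hsurj : Function.Surjective F := by
    intro y
    have h1 := sunToRays_raysToSun hB hW fun t k => y t k
    -- The norm identity holds for arbitrary families, so it may be used before square summability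
    -- of the preimage is known.
    have h2 : Memℓp (raysToSun B W fun t k => y t k) 2 := by
      refine memℓp_two_of_tsum_enorm_sq ?_
      rw [← tsum_enorm_sq_sunToRays hB' hW', h1, PiLp.sum_tsum_enorm_sq]
      exact ENNReal.ofReal_ne_top
    refine ⟨⟨_, h2⟩, ?_⟩
    ext t k
    exact congrFun (congrFun h1 t) k
  exact ⟨LinearIsometryEquiv.ofSurjective ⟨F, hnorm⟩ hsurj, hF⟩

/-- In the coordinates `sunToRays` the adjacency operator is an orthogonal sum of Jacobi
operators. -/
theorem unitarilyEquivalent_sunOperator_orthogonalSum [Fintype V] [Fintype J] [Fintype C]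
    (G : WeightedGraph V) (hp : 1 ≤ p)
    (hJ : Fintype.card J = Fintype.card V) (hC : Fintype.card C = (p - 1) * Fintype.card V)
    (eig : J → ℝ) [DecidableEq V]
    (heig : G.adjMatrix.charpoly = ∏ j, (Polynomial.X - Polynomial.C (eig j))) :
    UnitarilyEquivalent (G.sunOperator p)
      (orthogonalSum (Sum.elim (fun j : J => jacobiHead (eig j) (√(p : ℝ)))
        (fun _ : C => freeJacobi))) := by
  classical
  have hcard : Fintype.card (J ⊕ C) = Fintype.card (V × Fin p) := by
    obtain ⟨q, rfl⟩ := Nat.exists_eq_add_of_le' hp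
    rw [Fintype.card_sum, hJ, hC, Fintype.card_prod, Fintype.card_fin, Nat.add_sub_cancel]
    ring
  obtain ⟨B, hB, hB', hBM⟩ := Matrix.exists_orthogonal_diagonalization G.adjMatrix_symm eig heig
  obtain ⟨W, hW, hW', hWl, hWr⟩ := Matrix.exists_orthogonal_extension (C := C) hp hcard hB hB'
  obtain ⟨U, hU⟩ := exists_linearIsometryEquiv_sunToRays hB hB' hW hW'
  have hp' : (0 : ℝ) < p := by exact_mod_cast hp
  have hWl' : ∀ j v i, (√(p : ℝ) : ℂ) * W (.inl j) (v, i) = B j v := by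
    intro j v i
    rw [← hWl j v i, Complex.ofReal_mul]
  have hBM' : ∀ j v, ∑ u, (B j u : ℂ) * G.adjMatrix u v = eig j * B j v := by
    intro j v
    rw [← Complex.ofReal_mul, ← hBM j v, Complex.ofReal_sum]
    simp
  have hsum : ∀ j v, ∑ i, (W (.inl j) (v, i) : ℂ) = √(p : ℝ) * B j v := by
    intro j v
    have h1 : ∀ i, W (.inl j) (v, i) = B j v / √(p : ℝ) := fun i => by
      rw [← hWl j v i]
      field_simp
    rw [← Complex.ofReal_mul, ← Complex.ofReal_sum]
    congr 1
    simp only [h1, Finset.sum_const, Finset.card_univ, Fintype.card_fin, nsmul_eq_mul]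
    field_simp
    rw [Real.sq_sqrt hp'.le, mul_comm]
  have hsum' : ∀ c v, ∑ i, (W (.inr c) (v, i) : ℂ) = 0 := by
    intro c v
    rw [← Complex.ofReal_sum, hWr c v, Complex.ofReal_zero]
  -- The coupling of the first level to `G` is through the row sums of `W` at each vertex: `√p * B j
  -- v` for `.inl j`, and `0` for `.inr c`.
  have hzero : ∀ (x : Ell2 (V ⊕ (V × Fin p × ℕ))) (t : J ⊕ C),
      ∑ q : V × Fin p, (W t q : ℂ) * G.sunOperator p x (.inr (q.1, q.2, 0))
        = ∑ v, (∑ i, (W t (v, i) : ℂ)) * x (.inl v)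
          + ∑ q : V × Fin p, (W t q : ℂ) * x (.inr (q.1, q.2, 1)) := by
    intro x t
    simp only [G.sunOperator_apply_inr_zero, mul_add, Finset.sum_add_distrib]
    rw [Fintype.sum_prod_type]
    simp only [Finset.sum_mul]
  have hsucc : ∀ (x : Ell2 (V ⊕ (V × Fin p × ℕ))) (t : J ⊕ C) (k : ℕ),
      ∑ q : V × Fin p, (W t q : ℂ) * G.sunOperator p x (.inr (q.1, q.2, k + 1))
        = ∑ q : V × Fin p, (W t q : ℂ) * x (.inr (q.1, q.2, k))
          + ∑ q : V × Fin p, (W t q : ℂ) * x (.inr (q.1, q.2, k + 2)) := by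
    intro x t k
    simp only [G.sunOperator_apply_inr_succ, mul_add, Finset.sum_add_distrib]
  refine ⟨U, fun x => ?_⟩
  ext t k
  rw [hU, orthogonalSum_apply]
  rcases t with j | c
  · rw [Sum.elim_inl]
    rcases k with _ | _ | k
    · rw [jacobiHead_apply_zero, hU, hU]
      simp only [sunToRays, G.sunOperator_apply_inl, mul_add, Finset.sum_add_distrib]
      congr 1
      · simp only [Finset.mul_sum]
        rw [Finset.sum_comm]
        refine Finset.sum_congr rfl fun v _ => ?_
        rw [← mul_assoc, ← hBM', Finset.sum_mul]
        simp only [mul_assoc]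
      · rw [Fintype.sum_prod_type]
        simp only [Finset.mul_sum]
        refine Finset.sum_congr rfl fun v _ => Finset.sum_congr rfl fun i _ => ?_
        rw [← mul_assoc, hWl']
    · rw [jacobiHead_apply_one, hU, hU]
      simp only [sunToRays]
      rw [hzero]
      simp only [hsum, Finset.mul_sum, mul_assoc]
    · rw [jacobiHead_apply_add_two, hU, hU]
      exact hsucc x (.inl j) k
  · rw [Sum.elim_inr]
    cases k with
    | zero =>
      rw [freeJacobi_apply_zero, hU]
      simp only [sunToRays]
      rw [hzero]
      simp [hsum']
    | succ k =>
      rw [freeJacobi_apply_succ, hU, hU]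
      exact hsucc x (.inr c) k

end Decomposition

/-! ### Spectra of orthogonal sums, and the theorem -/

section SpectrumOfSums

theorem UnitarilyEquivalent.spectrum_eq {H K : Type*} [NormedAddCommGroup H]
    [InnerProductSpace ℂ H] [CompleteSpace H] [NormedAddCommGroup K] [InnerProductSpace ℂ K]
    [CompleteSpace K] {S : H →L[ℂ] H} {T : K →L[ℂ] K} (h : UnitarilyEquivalent S T) :
    spectrum ℂ S = spectrum ℂ T := by
  obtain ⟨U, hU⟩ := h
  ext z
  rw [S.mem_spectrum_iff_not_bijective, T.mem_spectrum_iff_not_bijective, not_iff_not]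
  have h1 : (U ∘ fun x => z • x - S x) = (fun x => z • x - T x) ∘ U := by
    ext x
    simp [hU]
  rw [← U.bijective.of_comp_iff (fun x => z • x - T x), ← h1, U.bijective.of_comp_iff']

theorem spectrum_orthogonalSum {I H : Type*} [Fintype I] [NormedAddCommGroup H]
    [InnerProductSpace ℂ H] [CompleteSpace H] (T : I → H →L[ℂ] H) :
    spectrum ℂ (orthogonalSum T) = ⋃ i, spectrum ℂ (T i) := by
  ext z
  rw [Set.mem_iUnion, ContinuousLinearMap.mem_spectrum_iff_not_bijective]
  simp only [ContinuousLinearMap.mem_spectrum_iff_not_bijective]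
  rw [← not_forall, not_iff_not]
  have h1 : (fun x : PiLp 2 (fun _ : I => H) => z • x - orthogonalSum T x)
      = (WithLp.equiv 2 (I → H)).symm ∘ Pi.map (fun i x => z • x - T i x)
        ∘ WithLp.equiv 2 (I → H) := rfl
  rw [h1, (Equiv.bijective _).of_comp_iff', (Equiv.bijective _).of_comp_iff]
  refine ⟨fun h i => ⟨Pi.map_injective.1 h.1 i, fun y => ?_⟩, Function.Bijective.piMap⟩
  obtain ⟨x, hx⟩ := h.2 fun _ => y
  exact ⟨x i, congrFun hx i⟩

end SpectrumOfSums

theorem mainTheorem4 (n : ℕ) (hn : 1 ≤ n) (G : WeightedGraph (Fin n)) (p : ℕ) (hp : 1 ≤ p)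
    (eig : Fin n → ℝ)
    (heig : G.adjMatrix.charpoly = ∏ j, (Polynomial.X - Polynomial.C (eig j))) :
    UnitarilyEquivalent (G.sunOperator p)
      (orthogonalSum (Sum.elim (fun j : Fin n => jacobiHead (eig j) (√(p : ℝ)))
        (fun _ : Fin ((p - 1) * n) => freeJacobi))) ∧
    spectrum ℂ (G.sunOperator p) =
      (fun x : ℝ => (x : ℂ)) '' Set.Icc (-2) 2 ∪
        ⋃ j : Fin n, discreteSpectrum (jacobiHead (eig j) (√(p : ℝ))) := by
  have hU := unitarilyEquivalent_sunOperator_orthogonalSum (C := Fin ((p - 1) * n)) G hp rfl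
    (by simp) eig heig
  have hs : 0 < √(p : ℝ) := Real.sqrt_pos.2 (by exact_mod_cast hp)
  -- With no index `j` the interval could not be taken out of the union; the `J₀` summands, absent
  -- when `p = 1`, only contribute it again.
  have : Nonempty (Fin n) := ⟨⟨0, hn⟩⟩
  refine ⟨hU, ?_⟩
  rw [hU.spectrum_eq, spectrum_orthogonalSum, Set.iUnion_sum]
  simp only [Sum.elim_inl, Sum.elim_inr, spectrum_jacobiHead _ hs, spectrum_freeJacobi]
  rw [← Set.union_iUnion, Set.union_eq_left]
  exact Set.iUnion_subset fun _ => Set.subset_union_left
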